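/- Let $X_1,X_2,\dots$ be nonempty finite sets with $|X_1|<|X_2|<\cdots$, let $\omega$ be a nonprincipal ultrafilter on $\mathbb N$, and let $k\ge 0$ be an integer, $[k]=\{1,\dots,k\}$. For $A\subseteq[k]$ let $\mathbf X^A$ be the ultraproduct along $\omega$ of the finite sets $X_i^A$, that is, $\prod_i X_i^A$ modulo equality of sequences on a set of indices in $\omega$. For sets $A_i\subseteq X_i^A$ the internal set $[\{A_i\}]\subseteq\mathbf X^A$ consists of the classes of those $(p_i)$ with $\{i: p_i\in A_i\}\in\omega$; put $\mu_A([\{A_i\}])=\lim_\omega |A_i|/|X_i^A|$. A subset of $\mathbf X^A$ is null if for every $\varepsilon>0$ it is contained in an internal set of measure at most $\varepsilon$. A set $B\subseteq\mathbf X^A$ is measurable if $B\,\triangle\,\widetilde B$ is null for some internal set $\widetilde B$, and then $\mu_A(B)=\mu_A(\widetilde B)$. This defines a $\sigma$-algebra $\mathcal B_A$ on $\mathbf X^A$ and a probability measure $\mu_A$ on it. Let $p_A:\mathbf X^{[k]}\to\mathbf X^A$ be the projection, let $\sigma(A)=p_A^{-1}(\mathcal B_A)$, and for $A\neq\emptyset$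 let $\sigma(A)^*$ be the $\sigma$-algebra on $\mathbf X^{[k]}$ generated by all $\sigma(B)$ with $B\subseteq A$ and $|B|=|A|-1$. **Proposition (random partitions).** For every nonempty $A\subseteq[k]$ and every integer $n\ge 1$ there is a partition $\mathbf X^A=S_1\cup S_2\cup\dots\cup S_n$ into measurable sets such that, for every $j=1,\dots,n$, $$E\big(S_j\mid\sigma(A)^*\big)=\tfrac1n\qquad \mu_{[k]}\text{-almost everywhere},$$ where $E(S_j\mid\sigma(A)^*)$ denotes the conditional expectation, on $(\mathbf X^{[k]},\mathcal B_{[k]},\mu_{[k]})$, of the indicator function of $p_A^{-1}(S_j)$ with respect to $\sigma(A)^*$. -/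

import Mathlib

open Filter Topology MeasureTheory
open scoped ENNReal symmDiff

namespace Loeb

universe u

/-- The ultraproduct of a sequence of sets along an ultrafilter `ω` on `ℕ`:
the product `∏ i, Y i` modulo equality on a set of indices that belongs to `ω`. -/
def Ultraproduct (ω : Ultrafilter ℕ) (Y : ℕ → Type u) : Type u :=
  (ω : Filter ℕ).Product Y

/-- The class of a sequence of points in the ultraproduct. -/
def Ultraproduct.mk (ω : Ultrafilter ℕ) {Y : ℕ → Type u} (p : ∀ i, Y i) : Ultraproduct ω Y :=
  Quotient.mk (Filter.productSetoid (ω : Filter ℕ) Y) p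

/-- The normalized counting measure `|s| / |Y|` of a subset of a finite set. -/
noncomputable def density {Y : Type u} (s : Set Y) : ℝ≥0∞ := (s.ncard : ℝ≥0∞) / (Nat.card Y : ℝ≥0∞)

section Construction

variable (ω : Ultrafilter ℕ) {Y : ℕ → Type u}

/-- The internal subset `[{s i}]` of the ultraproduct: the classes of the sequences `p` with
`p i ∈ s i` for `ω`-almost all `i`. -/
def internal (s : ∀ i, Set (Y i)) : Set (Ultraproduct ω Y) :=
  {x | ∃ p : ∀ i, Y i, Ultraproduct.mk ω p = x ∧ ∀ᶠ i in (ω : Filter ℕ), p i ∈ s i}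

/-- The ultralimit of the normalized counting measures of the sets `s i`. -/
noncomputable def ultraDensity (s : ∀ i, Set (Y i)) : ℝ≥0∞ :=
  limUnder (ω : Filter ℕ) fun i => density (s i)

/-- Null sets: sets that are covered by internal sets of arbitrarily small measure. -/
def IsNull (N : Set (Ultraproduct ω Y)) : Prop :=
  ∀ ε : ℝ≥0∞, 0 < ε → ∃ s : ∀ i, Set (Y i), N ⊆ internal ω s ∧ ultraDensity ω s ≤ ε

/-- Measurable sets: sets that differ from an internal set by a null set. -/
def IsMeas (B : Set (Ultraproduct ω Y)) : Prop :=
  ∃ s : ∀ i, Set (Y i), IsNull ω (B ∆ internal ω s)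

variable {ω}

theorem mk_mem_internal {s : ∀ i, Set (Y i)} {p : ∀ i, Y i} :
    Ultraproduct.mk ω p ∈ internal ω s ↔ ∀ᶠ i in (ω : Filter ℕ), p i ∈ s i := by
  constructor
  · rintro ⟨q, hq, h⟩
    have hq' : ∀ᶠ i in (ω : Filter ℕ), q i = p i := Quotient.exact hq
    filter_upwards [hq', h] with i h1 h2
    exact h1 ▸ h2
  · intro h
    exact ⟨p, rfl, h⟩

theorem exists_mk (x : Ultraproduct ω Y) : ∃ p, Ultraproduct.mk ω p = x :=
  Quotient.exists_rep x

theorem internal_compl (s : ∀ i, Set (Y i)) :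
    internal ω (fun i => (s i)ᶜ) = (internal ω s)ᶜ := by
  ext x
  obtain ⟨p, rfl⟩ := exists_mk x
  rw [Set.mem_compl_iff, mk_mem_internal, mk_mem_internal, ← Ultrafilter.eventually_not]
  rfl

theorem internal_union (s t : ∀ i, Set (Y i)) :
    internal ω (fun i => s i ∪ t i) = internal ω s ∪ internal ω t := by
  ext x
  obtain ⟨p, rfl⟩ := exists_mk x
  rw [Set.mem_union, mk_mem_internal, mk_mem_internal, mk_mem_internal,
    ← Ultrafilter.eventually_or]
  rfl

theorem internal_inter (s t : ∀ i, Set (Y i)) :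
    internal ω (fun i => s i ∩ t i) = internal ω s ∩ internal ω t := by
  ext x
  obtain ⟨p, rfl⟩ := exists_mk x
  rw [Set.mem_inter_iff, mk_mem_internal, mk_mem_internal, mk_mem_internal,
    ← Filter.eventually_and]
  rfl

theorem internal_mono {s t : ∀ i, Set (Y i)} (h : ∀ᶠ i in (ω : Filter ℕ), s i ⊆ t i) :
    internal ω s ⊆ internal ω t := by
  intro x
  obtain ⟨p, rfl⟩ := exists_mk x
  rw [mk_mem_internal, mk_mem_internal]
  intro h1
  filter_upwards [h, h1] with i h2 h3 using h2 h3

theorem internal_empty : internal ω (fun i => (∅ : Set (Y i))) = ∅ := by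
  ext x
  obtain ⟨p, rfl⟩ := exists_mk x
  simp [mk_mem_internal, ω.neBot.ne]

theorem eventually_subset [∀ i, Nonempty (Y i)] {s t : ∀ i, Set (Y i)}
    (h : internal ω s ⊆ internal ω t) : ∀ᶠ i in (ω : Filter ℕ), s i ⊆ t i := by
  by_contra hc
  rw [← Ultrafilter.eventually_not] at hc
  have hp : ∀ i, ∃ y : Y i, ¬ s i ⊆ t i → y ∈ s i ∧ y ∉ t i := by
    intro i
    by_cases hi : s i ⊆ t i
    · exact ⟨Classical.arbitrary _, fun h => absurd hi h⟩
    · obtain ⟨y, hy⟩ := Set.not_subset.1 hi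
      exact ⟨y, fun _ => hy⟩
  choose p hp using hp
  have h1 : Ultraproduct.mk ω p ∈ internal ω s :=
    mk_mem_internal.2 (hc.mono fun i hi => (hp i hi).1)
  have h2 := mk_mem_internal.1 (h h1)
  obtain ⟨i, hi, hi'⟩ := (hc.and h2).exists
  exact (hp i hi).2 hi'

theorem tendsto_ultraDensity (s : ∀ i, Set (Y i)) :
    Tendsto (fun i => density (s i)) (ω : Filter ℕ) (𝓝 (ultraDensity ω s)) := by
  apply tendsto_nhds_limUnder
  obtain ⟨x, -, hx⟩ := isCompact_univ.ultrafilter_le_nhds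
    (ω.map fun i => density (s i)) (by rw [Filter.principal_univ]; exact le_top)
  exact ⟨x, hx⟩

theorem ultraDensity_congr {s t : ∀ i, Set (Y i)} (h : ∀ᶠ i in (ω : Filter ℕ), s i = t i) :
    ultraDensity ω s = ultraDensity ω t :=
  tendsto_nhds_unique ((tendsto_ultraDensity s).congr'
    (h.mono fun i hi => by simp only [hi])) (tendsto_ultraDensity t)

theorem ultraDensity_empty : ultraDensity ω (fun i => (∅ : Set (Y i))) = 0 :=
  tendsto_nhds_unique (tendsto_ultraDensity _) (by simp [density])

theorem internal_partial (s : ℕ → ∀ i, Set (Y i)) (n : ℕ) :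
    internal ω (fun i => ⋃ j < n, s j i) = ⋃ j < n, internal ω (s j) := by
  induction n with
  | zero => simp [internal_empty]
  | succ n ih =>
    simp only [Set.biUnion_lt_succ]
    rw [internal_union, ih]

theorem IsNull.mono {N M : Set (Ultraproduct ω Y)} (hN : IsNull ω N) (h : M ⊆ N) :
    IsNull ω M := fun ε hε =>
  let ⟨s, hs, hs'⟩ := hN ε hε
  ⟨s, h.trans hs, hs'⟩

theorem isNull_empty : IsNull ω (∅ : Set (Ultraproduct ω Y)) := fun ε _ =>
  ⟨fun _ => ∅, Set.empty_subset _, by rw [ultraDensity_empty]; exact zero_le⟩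

theorem monotone_partial (s : ℕ → ∀ i, Set (Y i)) (i : ℕ) :
    Monotone fun n => ⋃ j < n, s j i := fun _ _ h =>
  Set.biUnion_subset_biUnion_left fun _ hj => lt_of_lt_of_le hj h

theorem iUnion_symmDiff_subset (f g : ℕ → Set (Ultraproduct ω Y)) (c : Set (Ultraproduct ω Y)) :
    (⋃ k, f k) ∆ c ⊆ (⋃ k, f k ∆ g k) ∪ (⋃ k, g k) ∆ c := by
  intro x hx
  simp only [Set.mem_symmDiff, Set.mem_union, Set.mem_iUnion] at hx ⊢
  grind

variable [∀ i, Finite (Y i)]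

theorem density_mono {Z : Type u} [Finite Z] {s t : Set Z} (h : s ⊆ t) :
    density s ≤ density t := by
  unfold density
  gcongr
  exact Set.toFinite t

theorem density_union_add_inter {Z : Type u} [Finite Z] (s t : Set Z) :
    density (s ∪ t) + density (s ∩ t) = density s + density t := by
  unfold density
  rw [← ENNReal.add_div, ← ENNReal.add_div]
  congr 1
  exact_mod_cast Set.ncard_union_add_ncard_inter s t (Set.toFinite s) (Set.toFinite t)

theorem density_le_one {Z : Type u} [Finite Z] (s : Set Z) : density s ≤ 1 := by
  refine ENNReal.div_le_of_le_mul ?_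
  rw [one_mul]
  exact_mod_cast Set.ncard_le_card s

theorem ultraDensity_le_one (s : ∀ i, Set (Y i)) : ultraDensity ω s ≤ 1 :=
  le_of_tendsto' (tendsto_ultraDensity s) fun _ => density_le_one _

theorem ultraDensity_mono {s t : ∀ i, Set (Y i)} (h : ∀ᶠ i in (ω : Filter ℕ), s i ⊆ t i) :
    ultraDensity ω s ≤ ultraDensity ω t :=
  le_of_tendsto_of_tendsto (tendsto_ultraDensity s) (tendsto_ultraDensity t)
    (h.mono fun _ hi => density_mono hi)

theorem ultraDensity_union_add_inter (s t : ∀ i, Set (Y i)) :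
    ultraDensity ω (fun i => s i ∪ t i) + ultraDensity ω (fun i => s i ∩ t i)
      = ultraDensity ω s + ultraDensity ω t := by
  refine tendsto_nhds_unique
    ((tendsto_ultraDensity (fun i => s i ∪ t i)).add (tendsto_ultraDensity fun i => s i ∩ t i)) ?_
  simp only [density_union_add_inter]
  exact (tendsto_ultraDensity s).add (tendsto_ultraDensity t)

theorem ultraDensity_union_le (s t : ∀ i, Set (Y i)) :
    ultraDensity ω (fun i => s i ∪ t i) ≤ ultraDensity ω s + ultraDensity ω t := by
  rw [← ultraDensity_union_add_inter]
  exact le_self_add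

theorem ultraDensity_partial_le (s : ℕ → ∀ i, Set (Y i)) (n : ℕ) :
    ultraDensity ω (fun i => ⋃ j < n, s j i) ≤ ∑ j ∈ Finset.range n, ultraDensity ω (s j) := by
  induction n with
  | zero => simp [ultraDensity_empty]
  | succ n ih =>
    simp only [Set.biUnion_lt_succ]
    rw [Finset.sum_range_succ]
    exact (ultraDensity_union_le _ _).trans (by gcongr)

/-- An increasing sequence of internal sets is contained in an internal set whose measure is the
limit of the measures. -/
theorem exists_cover (s : ℕ → ∀ i, Set (Y i)) (hs : ∀ i, Monotone fun n => s n i) :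
    ∃ c : ∀ i, Set (Y i), (∀ n, ∀ᶠ i in (ω : Filter ℕ), s n i ⊆ c i) ∧
      ultraDensity ω c = ⨆ n, ultraDensity ω (s n) := by
  set t := ⨆ n, ultraDensity ω (s n) with ht
  have ht1 : t ≤ 1 := iSup_le fun n => ultraDensity_le_one _
  have htop : t ≠ ∞ := ne_top_of_le_ne_top ENNReal.one_ne_top ht1
  let T : ℕ → ℕ → Prop := fun l i => density (s l i) ≤ t + ((l : ℝ≥0∞) + 1)⁻¹
  have hT : ∀ l, ∀ᶠ i in (ω : Filter ℕ), T l i := by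
    intro l
    have : ultraDensity ω (s l) < t + ((l : ℝ≥0∞) + 1)⁻¹ :=
      (le_iSup (fun n => ultraDensity ω (s n)) l).trans_lt
        (ENNReal.lt_add_right htop (by simp))
    filter_upwards [(tendsto_ultraDensity (s l)).eventually (gt_mem_nhds this)] with i hi
    exact hi.le
  have hT' : ∀ n, ∀ᶠ i in (ω : Filter ℕ), ∀ l ≤ n, T l i := by
    intro n
    exact (Set.finite_Iic n).eventually_all.2 fun l _ => hT l
  let c : ∀ i, Set (Y i) := fun i => ⋃ k ∈ {k | ∀ l ≤ k, T l i}, s k i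
  have hc : ∀ n, ∀ᶠ i in (ω : Filter ℕ), s n i ⊆ c i := by
    intro n
    filter_upwards [hT' n] with i hi
    exact Set.subset_biUnion_of_mem (s := {k | ∀ l ≤ k, T l i}) (u := fun k => s k i) hi
  refine ⟨c, hc, le_antisymm ?_ (iSup_le fun n => ultraDensity_mono (hc n))⟩
  have key : ∀ n : ℕ, ultraDensity ω c ≤ t + ((n : ℝ≥0∞) + 1)⁻¹ := by
    intro n
    refine le_of_tendsto (tendsto_ultraDensity c) ?_
    filter_upwards [hT' n] with i hi
    have hdir : DirectedOn (fun a b => s a i ⊆ s b i) {k | ∀ l ≤ k, T l i} := by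
      intro a ha b hb
      rcases le_total a b with h | h
      · exact ⟨b, hb, hs i h, le_rfl⟩
      · exact ⟨a, ha, le_rfl, hs i h⟩
    obtain ⟨F, hF⟩ := (Set.toFinite (c i)).exists_finset_coe
    have hsub : (F : Set (Y i)) ⊆ ⋃ k ∈ {k | ∀ l ≤ k, T l i}, s k i := by rw [hF]
    obtain ⟨m, hm, hFm⟩ := hdir.exists_mem_subset_of_finset_subset_biUnion
      ⟨n, show n ∈ {k | ∀ l ≤ k, T l i} from hi⟩ hsub
    rw [hF] at hFm
    rcases le_total m n with h | h
    · exact (density_mono (hFm.trans (hs i h))).trans (hi n le_rfl)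
    · refine (density_mono hFm).trans ((hm m le_rfl).trans ?_)
      gcongr
  have hlim : Tendsto (fun n : ℕ => t + ((n : ℝ≥0∞) + 1)⁻¹) atTop (𝓝 (t + 0)) := by
    refine tendsto_const_nhds.add ?_
    have := (tendsto_add_atTop_iff_nat 1).2 ENNReal.tendsto_inv_nat_nhds_zero
    simpa using this
  rw [add_zero] at hlim
  exact ge_of_tendsto' hlim key

theorem IsNull.iUnion {N : ℕ → Set (Ultraproduct ω Y)} (hN : ∀ k, IsNull ω (N k)) :
    IsNull ω (⋃ k, N k) := by
  intro ε hε
  obtain ⟨δ, hδ, hδε⟩ := ENNReal.exists_pos_sum_of_countable' hε.ne' ℕ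
  choose s hs hs' using fun k => hN k (δ k) (hδ k)
  obtain ⟨c, hc, hc'⟩ := exists_cover (ω := ω) (fun n i => ⋃ j < n, s j i) (monotone_partial s)
  refine ⟨c, Set.iUnion_subset fun k => (hs k).trans ?_, ?_⟩
  · refine internal_mono ((hc (k + 1)).mono fun i hi => Set.Subset.trans ?_ hi)
    exact Set.subset_biUnion_of_mem (u := fun j => s j i) (Nat.lt_succ_self k)
  · rw [hc']
    refine iSup_le fun n => (ultraDensity_partial_le s n).trans ?_
    exact (Finset.sum_le_sum fun j _ => hs' j).trans ((ENNReal.sum_le_tsum _).trans hδε.le)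

theorem IsNull.union {N M : Set (Ultraproduct ω Y)} (hN : IsNull ω N) (hM : IsNull ω M) :
    IsNull ω (N ∪ M) := by
  refine (IsNull.iUnion (N := fun k : ℕ => if k = 0 then N else M) fun k => ?_).mono ?_
  · split_ifs <;> assumption
  · rintro x (hx | hx)
    · exact Set.mem_iUnion.2 ⟨0, by simpa using hx⟩
    · exact Set.mem_iUnion.2 ⟨1, by simpa using hx⟩

/-- A countable union of internal sets is internal up to a null set. -/
theorem exists_iUnion_internal (s : ℕ → ∀ i, Set (Y i)) :
    ∃ c : ∀ i, Set (Y i), IsNull ω ((⋃ k, internal ω (s k)) ∆ internal ω c) ∧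
      ultraDensity ω c = ⨆ n, ultraDensity ω (fun i => ⋃ j < n, s j i) := by
  obtain ⟨c, hc, hc'⟩ := exists_cover (ω := ω) (fun n i => ⋃ j < n, s j i) (monotone_partial s)
  refine ⟨c, ?_, hc'⟩
  have hsub : (⋃ k, internal ω (s k)) ⊆ internal ω c := by
    refine Set.iUnion_subset fun k =>
      internal_mono ((hc (k + 1)).mono fun i hi => Set.Subset.trans ?_ hi)
    exact Set.subset_biUnion_of_mem (u := fun j => s j i) (Nat.lt_succ_self k)
  intro ε hε
  have hfin : ultraDensity ω c ≠ ∞ :=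
    ne_top_of_le_ne_top ENNReal.one_ne_top (ultraDensity_le_one c)
  have hex : ∃ n, ultraDensity ω c ≤ ultraDensity ω (fun i => ⋃ j < n, s j i) + ε := by
    by_cases h0 : ultraDensity ω c = 0
    · exact ⟨0, by rw [h0]; exact zero_le⟩
    have : ultraDensity ω c - ε < ⨆ n, ultraDensity ω (fun i => ⋃ j < n, s j i) := by
      rw [← hc']
      exact ENNReal.sub_lt_self hfin h0 hε.ne'
    obtain ⟨n, hn⟩ := lt_iSup_iff.1 this
    exact ⟨n, tsub_le_iff_right.1 hn.le⟩
  obtain ⟨n, hn⟩ := hex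
  refine ⟨fun i => c i ∩ (⋃ j < n, s j i)ᶜ, ?_, ?_⟩
  · rw [internal_inter, internal_compl, internal_partial]
    rintro x (⟨hx, hx'⟩ | ⟨hx, hx'⟩)
    · exact absurd (hsub hx) hx'
    · refine ⟨hx, fun h => hx' ?_⟩
      obtain ⟨j, -, hj⟩ := Set.mem_iUnion₂.1 h
      exact Set.mem_iUnion.2 ⟨j, hj⟩
  · have h1 := ultraDensity_union_add_inter (ω := ω) (fun i => c i ∩ (⋃ j < n, s j i)ᶜ)
      (fun i => ⋃ j < n, s j i)
    have h2 : ultraDensity ω (fun i => (c i ∩ (⋃ j < n, s j i)ᶜ) ∩ ⋃ j < n, s j i) = 0 := by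
      rw [← ultraDensity_empty (ω := ω) (Y := Y)]
      refine ultraDensity_congr (Eventually.of_forall fun i => ?_)
      rw [Set.inter_assoc, Set.compl_inter_self, Set.inter_empty]
    have h3 : ultraDensity ω (fun i => (c i ∩ (⋃ j < n, s j i)ᶜ) ∪ ⋃ j < n, s j i)
        = ultraDensity ω c := by
      refine ultraDensity_congr ((hc n).mono fun i hi => ?_)
      rw [← Set.sdiff_eq, Set.sdiff_union_of_subset hi]
    rw [h2, h3, add_zero] at h1
    have hfin' : ultraDensity ω (fun i => ⋃ j < n, s j i) ≠ ∞ :=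
      ne_top_of_le_ne_top ENNReal.one_ne_top (ultraDensity_le_one _)
    rw [h1, add_comm _ ε] at hn
    exact (ENNReal.add_le_add_iff_right hfin').1 hn

/-- The `σ`-algebra of measurable subsets of the ultraproduct. -/
instance instMeasurableSpace : MeasurableSpace (Ultraproduct ω Y) where
  MeasurableSet' B := IsMeas ω B
  measurableSet_empty := ⟨fun _ => ∅, by rw [internal_empty, symmDiff_self]; exact isNull_empty⟩
  measurableSet_compl B := by
    rintro ⟨s, hs⟩
    refine ⟨fun i => (s i)ᶜ, ?_⟩
    rwa [internal_compl, compl_symmDiff_compl]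
  measurableSet_iUnion f hf := by
    choose s hs using hf
    obtain ⟨c, hc, -⟩ := exists_iUnion_internal (ω := ω) s
    exact ⟨c, ((IsNull.iUnion hs).union hc).mono (iUnion_symmDiff_subset _ _ _)⟩

theorem measurableSet_iff {B : Set (Ultraproduct ω Y)} :
    MeasurableSet B ↔ ∃ s : ∀ i, Set (Y i), IsNull ω (B ∆ internal ω s) := Iff.rfl

variable [∀ i, Nonempty (Y i)]

theorem ultraDensity_eq_zero {s : ∀ i, Set (Y i)} (h : IsNull ω (internal ω s)) :
    ultraDensity ω s = 0 := by
  refine le_antisymm (le_of_forall_pos_le_add fun ε hε => ?_) zero_le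
  obtain ⟨t, ht, ht'⟩ := h ε hε
  rw [zero_add]
  exact (ultraDensity_mono (eventually_subset ht)).trans ht'

theorem ultraDensity_le_of_null {s t : ∀ i, Set (Y i)}
    (h : IsNull ω (internal ω s ∆ internal ω t)) : ultraDensity ω s ≤ ultraDensity ω t := by
  have h0 : ultraDensity ω (fun i => s i ∩ (t i)ᶜ) = 0 := by
    refine ultraDensity_eq_zero (h.mono ?_)
    rw [internal_inter, internal_compl]
    exact fun x hx => Or.inl hx
  calc ultraDensity ω s ≤ ultraDensity ω (fun i => t i ∪ (s i ∩ (t i)ᶜ)) := by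
        refine ultraDensity_mono (Eventually.of_forall fun i x hx => ?_)
        by_cases hxt : x ∈ t i
        · exact Or.inl hxt
        · exact Or.inr ⟨hx, hxt⟩
    _ ≤ ultraDensity ω t + 0 := h0 ▸ ultraDensity_union_le _ _
    _ = ultraDensity ω t := add_zero _

/-- The measure of a measurable set does not depend on the internal set that represents it. -/
theorem ultraDensity_unique {B : Set (Ultraproduct ω Y)} {s t : ∀ i, Set (Y i)}
    (hs : IsNull ω (B ∆ internal ω s)) (ht : IsNull ω (B ∆ internal ω t)) :
    ultraDensity ω s = ultraDensity ω t := by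
  have h : IsNull ω (internal ω s ∆ internal ω t) := by
    refine (hs.union ht).mono ?_
    rw [symmDiff_comm B]
    exact symmDiff_triangle _ _ _
  exact le_antisymm (ultraDensity_le_of_null h) (ultraDensity_le_of_null (symmDiff_comm (internal ω s) _ ▸ h))

theorem ultraDensity_partial_eq {f : ℕ → Set (Ultraproduct ω Y)} {s : ℕ → ∀ i, Set (Y i)}
    (hs : ∀ k, IsNull ω (f k ∆ internal ω (s k))) (hf : Pairwise (Function.onFun Disjoint f))
    (n : ℕ) :
    ultraDensity ω (fun i => ⋃ j < n, s j i) = ∑ j ∈ Finset.range n, ultraDensity ω (s j) := by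
  induction n with
  | zero => simp [ultraDensity_empty]
  | succ n ih =>
    simp only [Set.biUnion_lt_succ]
    rw [Finset.sum_range_succ, ← ih, ← ultraDensity_union_add_inter]
    have h0 : ultraDensity ω (fun i => (⋃ j < n, s j i) ∩ s n i) = 0 := by
      refine ultraDensity_eq_zero ((IsNull.iUnion hs).mono ?_)
      rw [internal_inter, internal_partial]
      rintro x ⟨hx, hxn⟩
      obtain ⟨j, hj, hxj⟩ := Set.mem_iUnion₂.1 hx
      by_cases h1 : x ∈ f n
      · have h2 : x ∉ f j := fun h => Set.disjoint_left.1 (hf (ne_of_lt hj)) h h1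
        exact Set.mem_iUnion.2 ⟨j, Or.inr ⟨hxj, h2⟩⟩
      · exact Set.mem_iUnion.2 ⟨n, Or.inr ⟨hxn, h1⟩⟩
    rw [h0, add_zero]

variable (ω Y) in
/-- The probability measure on the ultraproduct: a measurable set that differs from the internal
set `[{s i}]` by a null set has as its measure the ultralimit of `|s i| / |Y i|`. -/
noncomputable def measure : Measure (Ultraproduct ω Y) :=
  Measure.ofMeasurable (fun _ hB => ultraDensity ω (measurableSet_iff.1 hB).choose)
    (by
      have h := (measurableSet_iff.1 (MeasurableSet.empty (α := Ultraproduct ω Y))).choose_spec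
      refine (ultraDensity_unique h ?_).trans (ultraDensity_empty (ω := ω) (Y := Y))
      rw [internal_empty, symmDiff_self]
      exact isNull_empty)
    (by
      intro f hf hd
      have hs := fun k => (measurableSet_iff.1 (hf k)).choose_spec
      obtain ⟨c, hc, hc'⟩ :=
        exists_iUnion_internal (ω := ω) fun k => (measurableSet_iff.1 (hf k)).choose
      have hU := (measurableSet_iff.1 (MeasurableSet.iUnion hf)).choose_spec
      rw [ultraDensity_unique hU
        (((IsNull.iUnion hs).union hc).mono (iUnion_symmDiff_subset _ _ _)), hc',
        ENNReal.tsum_eq_iSup_nat]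
      exact iSup_congr fun n => ultraDensity_partial_eq hs hd n)

theorem measure_eq {B : Set (Ultraproduct ω Y)} {s : ∀ i, Set (Y i)}
    (h : IsNull ω (B ∆ internal ω s)) : measure ω Y B = ultraDensity ω s := by
  have hB : MeasurableSet B := ⟨s, h⟩
  rw [measure, Measure.ofMeasurable_apply B hB]
  exact ultraDensity_unique (measurableSet_iff.1 hB).choose_spec h

instance instIsProbabilityMeasure : IsProbabilityMeasure (measure ω Y) := by
  constructor
  have h : internal ω (fun i => (Set.univ : Set (Y i))) = Set.univ := by
    ext x
    obtain ⟨p, rfl⟩ := exists_mk x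
    simp [mk_mem_internal]
  rw [measure_eq (s := fun i => Set.univ) (by rw [h, symmDiff_self]; exact isNull_empty)]
  refine tendsto_nhds_unique (tendsto_ultraDensity _) ?_
  have : ∀ i, density (Set.univ : Set (Y i)) = 1 := fun i => by
    rw [density, Set.ncard_univ]
    exact ENNReal.div_self (by exact_mod_cast Nat.card_pos.ne') (ENNReal.natCast_ne_top _)
  simp [this]

end Construction

section Powers

/-- For an index set `J`, the space `X^J`: the ultraproduct of the finite sets `(X i)^J`. The
elements of `[k]` are modelled by `Fin k`, so that `X^{[k]}` is `Power ω X (Fin k)` and `X^A`, for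
`A ⊆ [k]`, is `Power ω X A`. -/
abbrev Power (ω : Ultrafilter ℕ) (X : ℕ → Type u) (J : Type) : Type u :=
  Ultraproduct ω fun i => J → X i

variable (ω : Ultrafilter ℕ) (X : ℕ → Type u) {k : ℕ}

/-- The projection `p_A : X^{[k]} → X^A`, which restricts tuples to the coordinates in `A`. -/
def proj (A : Finset (Fin k)) : Power ω X (Fin k) → Power ω X A :=
  Quotient.map (fun p i j => p i j) fun _ _ h => h.mono fun _ hi => by simp only [hi]

theorem proj_preimage_internal (A : Finset (Fin k)) (s : ∀ i, Set (A → X i)) :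
    proj ω X A ⁻¹' internal ω s = internal ω fun i => (fun p (j : A) => p j) ⁻¹' s i := by
  ext x
  obtain ⟨p, rfl⟩ := exists_mk x
  rw [mk_mem_internal]
  exact mk_mem_internal (p := fun i (j : A) => p i j)

variable [∀ i, Finite (X i)]

/-- `σ(A)`: the preimages under `p_A` of the measurable subsets of `X^A`. -/
@[reducible] def sigma (A : Finset (Fin k)) : MeasurableSpace (Power ω X (Fin k)) :=
  MeasurableSpace.comap (proj ω X A) inferInstance

/-- `σ(A)^*`: the `σ`-algebra generated by the `σ(B)` with `B ⊆ A` and `|B| = |A| - 1`. -/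
@[reducible] def sigmaStar (A : Finset (Fin k)) : MeasurableSpace (Power ω X (Fin k)) :=
  ⨆ B ∈ {B : Finset (Fin k) | B ⊆ A ∧ B.card + 1 = A.card}, sigma ω X B

theorem density_preimage {Z : Type u} [Finite Z] [Nonempty Z] (A : Finset (Fin k))
    (s : Set (A → Z)) : density ((fun (p : Fin k → Z) (j : A) => p j) ⁻¹' s) = density s := by
  let e := Equiv.piEquivPiSubtypeProd (fun j => j ∈ A) (fun _ : Fin k => Z)
  have h1 : (fun (p : Fin k → Z) (j : A) => p j) ⁻¹' s = e ⁻¹' (s ×ˢ Set.univ) := by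
    ext p
    simp [e, Equiv.piEquivPiSubtypeProd]
  have h2 : (e ⁻¹' (s ×ˢ Set.univ)).ncard = s.ncard * Nat.card ({j // j ∉ A} → Z) := by
    rw [← Equiv.image_symm_eq_preimage, Set.ncard_image_of_injective _ e.symm.injective,
      Set.ncard_prod, Set.ncard_univ]
  have h3 : Nat.card (Fin k → Z) = Nat.card (A → Z) * Nat.card ({j // j ∉ A} → Z) := by
    rw [Nat.card_congr e, Nat.card_prod]
  rw [density, density, h1, h2, h3, Nat.cast_mul, Nat.cast_mul]
  exact ENNReal.mul_div_mul_right _ _ (by exact_mod_cast Nat.card_pos.ne')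
    (ENNReal.natCast_ne_top _)

variable [∀ i, Nonempty (X i)]

/-- The projections are measurable, so that `σ(A)` consists of measurable subsets of `X^{[k]}`. -/
theorem measurable_proj (A : Finset (Fin k)) : Measurable (proj ω X A) := by
  rintro B ⟨s, hs⟩
  refine ⟨fun i => (fun p (j : A) => p j) ⁻¹' s i, fun ε hε => ?_⟩
  obtain ⟨t, ht, ht'⟩ := hs ε hε
  refine ⟨fun i => (fun p (j : A) => p j) ⁻¹' t i, ?_, ?_⟩
  · rw [← proj_preimage_internal, ← proj_preimage_internal]
    exact fun x hx => ht hx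
  · simpa only [ultraDensity, density_preimage] using ht'

theorem sigmaStar_le (A : Finset (Fin k)) : sigmaStar ω X A ≤ instMeasurableSpace :=
  iSup₂_le fun B _ => (measurable_proj ω X B).comap_le

end Powers

end Loeb

/-!
The parts `S j` are the internal colour classes of a sequence of colourings
`f i : (X i)^A → {1, …, n}` of the finite sets that are as random as possible.

Let `d = |A|` and `N = |X i|`. A set in the `π`-system of finite intersections of members of the
`σ(B)`, which generates `σ(A)^*`, is represented, up to a null set, by intersections of `d` subsets
of the `(X i)^A`, one for each coordinate in `A` and not depending on it
(`Loeb.exists_internal_of_mem_piiUnionInter`). There are at most `2 ^ (d * N ^ (d - 1))` such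
intersections. For a colouring chosen uniformly at random, the probability that a given colour
exceeds its share `1 / n` of a given one of them by more than `ε * N ^ d` points is at most
`exp (- ε ^ 2 * N ^ d / 4)` by Chernoff's bound (`Loeb.card_excess_colourings_le`). As `N ^ d` beats
`d * N ^ (d - 1)`, for large `N` some colouring has no such excess at all
(`Loeb.exists_isQuasirandom`). Taking for each `i` the colouring with the smallest excess makes the
excess tend to zero along `ω`.

In the limit each colour class has at most its share `1 / n` of each set of the `π`-system
(`Loeb.measureReal_inter_le`); since the classes partition the space, it has exactly that share
(`Loeb.measureReal_inter_eq_of_forall_le`). So the colour classes are independent of `σ(A)^*` and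
their conditional expectations are the constant `1 / n` (`Loeb.condExp_indicator_eq_measureReal`).
-/

namespace Loeb

universe v

/-! ### Quasirandom colourings of finite powers -/

section Finite

/-- A set of tuples ignores the coordinate `a` if membership of a tuple in it does not depend on
the value of the tuple at `a`. -/
def IgnoresCoord {J : Type*} {Z : Type v} (a : J) (T : Set (J → Z)) : Prop :=
  ∀ x y : J → Z, (∀ b, b ≠ a → x b = y b) → x ∈ T → y ∈ T

/-- A colouring of `Z^J` by `n` colours is `ε`-quasirandom if on each intersection of sets, one for
each coordinate and ignoring it, no colour has more than its share `1 / n` by more than the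
fraction `ε` of all the points. Only excesses are bounded: as the colour classes add up to the whole
set, this bounds the deficits too. -/
def IsQuasirandom {J : Type*} {Z : Type v} {n : ℕ} (ε : ℝ) (f : (J → Z) → Fin n) : Prop :=
  ∀ (j : Fin n) (T : J → Set (J → Z)), (∀ a, IgnoresCoord a (T a)) →
    ((f ⁻¹' {j} ∩ ⋂ a, T a).ncard : ℝ) ≤ (⋂ a, T a).ncard / n + ε * Nat.card (J → Z)

theorem IsQuasirandom.mono {J : Type*} {Z : Type v} {n : ℕ} {ε δ : ℝ} {f : (J → Z) → Fin n}
    (hf : IsQuasirandom ε f) (h : ε ≤ δ) : IsQuasirandom δ f := fun j T hT =>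
  (hf j T hT).trans (by gcongr)

/-- The exponential moment of the centred indicator of one colour out of `n`. -/
theorem sum_exp_indicator_le {n : ℕ} (hn : 1 ≤ n) (j : Fin n) {t : ℝ} (ht0 : 0 ≤ t)
    (ht1 : t ≤ 1) :
    ∑ v : Fin n, Real.exp (t * ((if v = j then 1 else 0) - 1 / n)) ≤ n * Real.exp (t ^ 2) := by
  have hn' : (1 : ℝ) ≤ n := by exact_mod_cast hn
  have hinv : (1 : ℝ) / n ≤ 1 := by rw [div_le_one (by linarith)]; exact hn'
  have hinv0 : (0 : ℝ) ≤ 1 / n := by positivity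
  have hterm : ∀ v : Fin n, Real.exp (t * ((if v = j then 1 else 0) - 1 / n))
      ≤ 1 + t * ((if v = j then 1 else 0) - 1 / n) + t ^ 2 := by
    intro v
    set c : ℝ := (if v = j then 1 else 0) - 1 / n with hc
    have hc1 : |c| ≤ 1 := by
      rw [hc, abs_le]
      split_ifs <;> constructor <;> linarith
    have htc : |t * c| ≤ 1 := by
      rw [abs_mul, abs_of_nonneg ht0]
      exact mul_le_one₀ ht1 (abs_nonneg c) hc1
    have h1 := (abs_le.1 (Real.abs_exp_sub_one_sub_id_le htc)).2
    have h2 : (t * c) ^ 2 ≤ t ^ 2 := by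
      rw [mul_pow]
      exact mul_le_of_le_one_right (sq_nonneg t) (by rwa [sq_le_one_iff_abs_le_one])
    linarith
  refine (Finset.sum_le_sum fun v _ => hterm v).trans ?_
  have hsum : ∑ v : Fin n, (1 + t * ((if v = j then 1 else 0) - 1 / n) + t ^ 2)
      = n * (t ^ 2 + 1) := by
    rw [Finset.sum_add_distrib, Finset.sum_add_distrib, ← Finset.mul_sum,
      Finset.sum_sub_distrib]
    simp only [Finset.sum_const, Finset.card_univ, Fintype.card_fin, nsmul_eq_mul,
      Finset.sum_ite_eq', Finset.mem_univ, if_true]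
    field_simp
    ring
  rw [hsum]
  gcongr
  exact Real.add_one_le_exp _

/-- Chernoff's bound for the number of colourings in which the colour `j` exceeds its share of the
points of `C`. -/
theorem card_excess_colourings_le {P : Type*} [Fintype P] [DecidableEq P] {n : ℕ} (hn : 1 ≤ n) (j : Fin n)
    (C : Finset P) {ε : ℝ} (hε0 : 0 ≤ ε) (hε1 : ε ≤ 1) :
    (({f : P → Fin n |
          (C.card : ℝ) / n + ε * Fintype.card P < (C.filter fun x => f x = j).card} :
        Finset (P → Fin n)).card : ℝ)
      ≤ (n : ℝ) ^ Fintype.card P * Real.exp (-(ε ^ 2 / 4 * Fintype.card P)) := by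
  -- `t = ε / 2` minimizes `t ^ 2 - t * ε`
  set t : ℝ := ε / 2 with ht
  set M := Fintype.card P
  set bad : Finset (P → Fin n) := {f : P → Fin n |
    (C.card : ℝ) / n + ε * M < (C.filter fun x => f x = j).card} with hbad
  let g : P → Fin n → ℝ := fun x v =>
    if x ∈ C then Real.exp (t * ((if v = j then 1 else 0) - 1 / n)) else 1
  have hg0 : ∀ x v, 0 ≤ g x v := fun x v => by
    simp only [g]; split_ifs <;> positivity
  have hgsum : ∀ x, ∑ v, g x v ≤ n * Real.exp (t ^ 2) := by
    intro x
    by_cases hx : x ∈ C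
    · simp only [g, hx, if_true]
      exact sum_exp_indicator_le hn j (by linarith) (by linarith)
    · simp only [g, hx, if_false, Finset.sum_const, Finset.card_univ, Fintype.card_fin,
        nsmul_eq_mul]
      gcongr
      exact Real.one_le_exp (sq_nonneg t)
  have hprod : ∀ f : P → Fin n, ∏ x, g x (f x)
      = Real.exp (t * ((C.filter fun x => f x = j).card - C.card / n)) := by
    intro f
    simp only [g]
    rw [Finset.prod_ite, Finset.prod_const_one, mul_one, ← Real.exp_sum, ← Finset.mul_sum,
      Finset.sum_sub_distrib, Finset.filter_univ_mem, Finset.sum_boole]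
    simp [div_eq_mul_inv]
  have htotal : ∑ f : P → Fin n, ∏ x, g x (f x) ≤ (n : ℝ) ^ M * Real.exp (t ^ 2 * M) := by
    have h := Finset.prod_univ_sum (fun _ : P => (Finset.univ : Finset (Fin n))) g
    rw [Fintype.piFinset_univ] at h
    rw [← h]
    refine (Finset.prod_le_prod (fun x _ => Finset.sum_nonneg fun v _ => hg0 x v)
      fun x _ => hgsum x).trans ?_
    rw [Finset.prod_const, Finset.card_univ, mul_pow, ← Real.exp_nat_mul, mul_comm (t ^ 2)]
  have hmarkov : (bad.card : ℝ) * Real.exp (t * (ε * M)) ≤ ∑ f : P → Fin n, ∏ x, g x (f x) := by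
    rw [← nsmul_eq_mul]
    refine (Finset.card_nsmul_le_sum bad _ _ fun f hf => ?_).trans
      (Finset.sum_le_sum_of_subset_of_nonneg (Finset.subset_univ bad) fun f _ _ =>
        Finset.prod_nonneg fun x _ => hg0 x _)
    rw [hprod]
    have := (Finset.mem_filter.1 hf).2
    gcongr
    linarith
  have hexp : Real.exp (t ^ 2 * M) = Real.exp (-(ε ^ 2 / 4 * M)) * Real.exp (t * (ε * M)) := by
    rw [← Real.exp_add, ht]
    congr 1
    ring
  have := hmarkov.trans htotal
  rw [hexp, ← mul_assoc ((n : ℝ) ^ M)] at this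
  exact le_of_mul_le_mul_right this (Real.exp_pos _)

/-- The intersection of one set for each coordinate `a`, ignoring `a`. A set that ignores `a` is
encoded by a set of tuples indexed by the other coordinates, which makes these sets easy to
count. -/
def cylinder {J : Type*} {Z : Type v} (s : ∀ a : J, Set ({b : J // b ≠ a} → Z)) : Set (J → Z) :=
  {x | ∀ a, (fun b : {b : J // b ≠ a} => x b) ∈ s a}

theorem exists_eq_cylinder {J : Type*} {Z : Type v} {T : J → Set (J → Z)}
    (hT : ∀ a, IgnoresCoord a (T a)) : ∃ s, ⋂ a, T a = cylinder s := by
  refine ⟨fun a => (fun x (b : {b : J // b ≠ a}) => x b) '' T a, ?_⟩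
  ext x
  simp only [Set.mem_iInter, cylinder, Set.mem_ofPred_eq]
  refine forall_congr' fun a => ⟨fun h => ⟨x, h, rfl⟩, ?_⟩
  rintro ⟨y, hy, hyx⟩
  exact hT a y x (fun b hb => congrFun hyx ⟨b, hb⟩) hy

open Classical in
/-- The number of the data that define cylinders, hence a bound for the number of cylinders. -/
theorem card_cylinder_data {J : Type*} [Fintype J] {Z : Type v} [Fintype Z] :
    Fintype.card (∀ a : J, Set ({b : J // b ≠ a} → Z))
      = (2 ^ Fintype.card J) ^ (Fintype.card Z ^ (Fintype.card J - 1)) := by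
  simp only [Fintype.card_pi, Fintype.card_set, ne_eq, Fintype.card_subtype_compl,
    Fintype.card_subtype_eq, Finset.prod_const, Finset.card_univ]
  rw [← pow_mul, ← pow_mul, mul_comm]

open Classical in
/-- The probabilistic method: fewer than `exp c` tests, each failed by a fraction of at most
`exp (-c)` of all the colourings, are all passed by some colouring. -/
theorem exists_forall_not_mem_of_card_lt {P D : Type*} [Fintype P] [Fintype D] {n : ℕ}
    (hn : 1 ≤ n) (bad : D → Finset (P → Fin n)) {c : ℝ}
    (hbad : ∀ p, ((bad p).card : ℝ) ≤ (n : ℝ) ^ Fintype.card P * Real.exp (-c))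
    (hD : (Fintype.card D : ℝ) < Real.exp c) : ∃ f, ∀ p, f ∉ bad p := by
  have hunion : ((Finset.univ.biUnion bad).card : ℝ) < (n : ℝ) ^ Fintype.card P := by
    calc ((Finset.univ.biUnion bad).card : ℝ) ≤ ∑ p, ((bad p).card : ℝ) := by
          exact_mod_cast Finset.card_biUnion_le
      _ ≤ Fintype.card D * ((n : ℝ) ^ Fintype.card P * Real.exp (-c)) := by
          refine (Finset.sum_le_sum fun p _ => hbad p).trans ?_
          rw [Finset.sum_const, Finset.card_univ, nsmul_eq_mul]
      _ < Real.exp c * ((n : ℝ) ^ Fintype.card P * Real.exp (-c)) := by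
          have h3 : (0 : ℝ) < n := by exact_mod_cast hn
          gcongr
      _ = (n : ℝ) ^ Fintype.card P := by
          rw [mul_left_comm, ← Real.exp_add, add_neg_cancel, Real.exp_zero, mul_one]
  by_contra! h
  have huniv : Finset.univ.biUnion bad = Finset.univ :=
    Finset.eq_univ_iff_forall.2 fun f =>
      let ⟨p, hp⟩ := h f
      Finset.mem_biUnion.2 ⟨p, Finset.mem_univ p, hp⟩
  rw [huniv, Finset.card_univ, Fintype.card_fun, Fintype.card_fin] at hunion
  push_cast at hunion
  exact lt_irrefl _ hunion

open Classical in
/-- With `K = N ^ (d - 1)` there are at most `(n * 2 ^ d) ^ K` pairs of a colour and an intersection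
to be tested, and Chernoff's exponent is `ε ^ 2 / 4 * N * K`, so a comparison without the power `K`
suffices. -/
theorem exists_isQuasirandom_of_lt_exp {J : Type*} [Fintype J] [Nonempty J] {Z : Type v}
    [Fintype Z] [Nonempty Z] {n : ℕ} (hn : 1 ≤ n) {ε : ℝ} (hε0 : 0 ≤ ε) (hε1 : ε ≤ 1)
    (hZ : ((n * 2 ^ Fintype.card J : ℕ) : ℝ) < Real.exp (ε ^ 2 / 4 * Fintype.card Z)) :
    ∃ f : (J → Z) → Fin n, IsQuasirandom ε f := by
  have hK0 : Fintype.card Z ^ (Fintype.card J - 1) ≠ 0 := pow_ne_zero _ Fintype.card_ne_zero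
  have hM : Fintype.card (J → Z) = Fintype.card Z ^ (Fintype.card J - 1) * Fintype.card Z := by
    rw [Fintype.card_fun, ← pow_succ, Nat.sub_add_cancel Fintype.card_pos]
  let bad : Fin n × (∀ a : J, Set ({b : J // b ≠ a} → Z)) → Finset ((J → Z) → Fin n) := fun p =>
    {f | ((cylinder p.2).toFinset.card : ℝ) / n + ε * Fintype.card (J → Z)
      < ((cylinder p.2).toFinset.filter fun x => f x = p.1).card}
  have hD : (Fintype.card (Fin n × (∀ a : J, Set ({b : J // b ≠ a} → Z))) : ℝ)
      < Real.exp (ε ^ 2 / 4 * Fintype.card (J → Z)) := by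
    rw [hM, Nat.cast_mul, mul_left_comm, Real.exp_nat_mul]
    refine lt_of_le_of_lt ?_ (pow_lt_pow_left₀ hZ (Nat.cast_nonneg _) hK0)
    rw [Fintype.card_prod, Fintype.card_fin, card_cylinder_data, ← Nat.cast_pow, mul_pow]
    exact Nat.cast_le.2 (Nat.mul_le_mul_right _ (Nat.le_self_pow hK0 n))
  obtain ⟨f, hf⟩ := exists_forall_not_mem_of_card_lt hn bad
    (fun p => card_excess_colourings_le hn p.1 _ hε0 hε1) hD
  refine ⟨f, fun j T hT => ?_⟩
  obtain ⟨s, hs⟩ := exists_eq_cylinder hT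
  have hfs := hf (j, s)
  simp only [bad, Finset.mem_filter, Finset.mem_univ, true_and, not_lt] at hfs
  rw [hs, Nat.card_eq_fintype_card, Set.ncard_eq_toFinset_card' (cylinder s)]
  refine le_of_eq_of_le ?_ hfs
  rw [Set.ncard_eq_toFinset_card', Nat.cast_inj]
  congr 1
  ext x
  simp [and_comm]

/-- Once `Z` is large, a colouring of `Z^J` chosen at random is `ε`-quasirandom with positive
probability, since the exponent `N ^ d` in Chernoff's bound beats the exponent `d * N ^ (d - 1)` in
the number of sets to be tested. -/
theorem exists_isQuasirandom (J : Type*) [Finite J] [Nonempty J] {n : ℕ} (hn : 1 ≤ n) {ε : ℝ}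
    (hε0 : 0 < ε) (hε1 : ε ≤ 1) :
    ∃ N₀ : ℕ, ∀ (Z : Type v) [Finite Z] [Nonempty Z], N₀ ≤ Nat.card Z →
      ∃ f : (J → Z) → Fin n, IsQuasirandom ε f := by
  have := Fintype.ofFinite J
  have hlim : Tendsto (fun N : ℕ => Real.exp (ε ^ 2 / 4 * N)) atTop atTop :=
    Real.tendsto_exp_atTop.comp (tendsto_natCast_atTop_atTop.const_mul_atTop (by positivity))
  obtain ⟨N₀, hN₀⟩ := eventually_atTop.1
    (hlim.eventually_gt_atTop ((n * 2 ^ Fintype.card J : ℕ) : ℝ))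
  refine ⟨N₀, fun Z _ _ hZ => ?_⟩
  have := Fintype.ofFinite Z
  rw [Nat.card_eq_fintype_card] at hZ
  exact exists_isQuasirandom_of_lt_exp hn hε0.le hε1 (hN₀ _ hZ)

/-- Among the finitely many colourings there is one that is as quasirandom as possible. -/
theorem exists_best_colouring {J : Type*} [Finite J] {Z : Type v} [Finite Z] {n : ℕ}
    (hn : 1 ≤ n) :
    ∃ f : (J → Z) → Fin n, ∀ ε, (∃ g : (J → Z) → Fin n, IsQuasirandom ε g) →
      IsQuasirandom ε f := by
  have : NeZero n := ⟨by lia⟩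
  by_contra! h
  choose ε hg hε using h
  -- a colouring that witnesses the least of the thresholds also meets its own threshold
  obtain ⟨f, hf⟩ := Finite.exists_min ε
  obtain ⟨g, hg⟩ := hg f
  exact hε g (hg.mono (hf g))

end Finite

/-! ### Internal colourings of the ultraproduct -/

section Colouring

variable {ω : Ultrafilter ℕ} {Y : ℕ → Type v} {n : ℕ}

theorem disjoint_internal_colour (f : ∀ i, Y i → Fin n) :
    Pairwise (Function.onFun Disjoint fun j => internal ω fun i => f i ⁻¹' {j}) := by
  intro j l hjl
  rw [Function.onFun, Set.disjoint_iff_inter_eq_empty, ← internal_inter]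
  have : ∀ i, f i ⁻¹' {j} ∩ f i ⁻¹' {l} = ∅ := fun i => by
    rw [← Set.preimage_inter, Set.singleton_inter_eq_empty.2 (by simpa using hjl),
      Set.preimage_empty]
  simp only [this, internal_empty]

theorem iUnion_internal_colour (f : ∀ i, Y i → Fin n) :
    (⋃ j, internal ω fun i => f i ⁻¹' {j}) = Set.univ := by
  refine Set.eq_univ_of_forall fun x => ?_
  obtain ⟨p, rfl⟩ := exists_mk x
  simp only [Set.mem_iUnion, mk_mem_internal, Set.mem_preimage, Set.mem_singleton_iff]
  exact Ultrafilter.eventually_exists_iff.1 (Eventually.of_forall fun i => ⟨f i (p i), rfl⟩)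

theorem isNull_symmDiff_self (B : Set (Ultraproduct ω Y)) : IsNull ω (B ∆ B) := by
  rw [symmDiff_self]
  exact isNull_empty

theorem measurableSet_internal [∀ i, Finite (Y i)] (s : ∀ i, Set (Y i)) :
    MeasurableSet (internal ω s) :=
  ⟨s, isNull_symmDiff_self _⟩

theorem internal_univ : internal ω (fun i => (Set.univ : Set (Y i))) = Set.univ := by
  rw [← compl_inj_iff, ← internal_compl, Set.compl_univ]
  simp only [Set.compl_univ, internal_empty]

/-- If the sets `s` and `t` represent `B` and `C` up to null sets, then `s ∩ t` represents
`B ∩ C`. -/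
theorem IsNull.symmDiff_inter [∀ i, Finite (Y i)] {B C : Set (Ultraproduct ω Y)}
    {s t : ∀ i, Set (Y i)}
    (hB : IsNull ω (B ∆ internal ω s)) (hC : IsNull ω (C ∆ internal ω t)) :
    IsNull ω ((B ∩ C) ∆ internal ω fun i => s i ∩ t i) := by
  refine (hB.union hC).mono ?_
  rw [internal_inter]
  intro x
  simp only [Set.mem_symmDiff, Set.mem_union, Set.mem_inter_iff]
  tauto

theorem IsNull.symmDiff_biInter [∀ i, Finite (Y i)] {ι : Type*} {t : Finset ι}
    {G : ι → Set (Ultraproduct ω Y)} {s : ι → ∀ i, Set (Y i)}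
    (h : ∀ B ∈ t, IsNull ω (G B ∆ internal ω (s B))) :
    IsNull ω ((⋂ B ∈ t, G B) ∆ internal ω fun i => ⋂ B ∈ t, s B i) := by
  classical
  induction t using Finset.induction_on with
  | empty => simpa [internal_univ] using isNull_empty
  | insert B t _ ih =>
    simp only [Finset.set_biInter_insert]
    exact (h B (Finset.mem_insert_self B t)).symmDiff_inter
      (ih fun C hC => h C (Finset.mem_insert_of_mem hC))

end Colouring

section Projection

variable {ω : Ultrafilter ℕ} {X : ℕ → Type v} {k : ℕ}

variable [∀ i, Finite (X i)] [∀ i, Nonempty (X i)]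

theorem IsNull.preimage_proj {A : Finset (Fin k)} {N : Set (Power ω X A)} (hN : IsNull ω N) :
    IsNull ω (proj ω X A ⁻¹' N) := by
  intro ε hε
  obtain ⟨t, ht, ht'⟩ := hN ε hε
  refine ⟨fun i => (fun (p : Fin k → X i) (j : A) => p j) ⁻¹' t i, ?_, ?_⟩
  · rw [← proj_preimage_internal]
    exact Set.preimage_mono ht
  · simpa only [ultraDensity, density_preimage] using ht'

/-- A set of the `π`-system that generates `σ(A)^*` is represented by intersections of subsets of
the `X_i^A`, one for each coordinate in `A` and ignoring it. -/
theorem exists_internal_of_mem_piiUnionInter {A : Finset (Fin k)} {G : Set (Power ω X (Fin k))}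
    (hG : G ∈ piiUnionInter (fun B => {s | MeasurableSet[sigma ω X B] s})
      {B : Finset (Fin k) | B ⊆ A ∧ B.card + 1 = A.card}) :
    ∃ T : ∀ i, A → Set (A → X i), (∀ i a, IgnoresCoord a (T i a)) ∧
      IsNull ω (G ∆ internal ω fun i => (fun (p : Fin k → X i) (j : A) => p j) ⁻¹' ⋂ a, T i a) := by
  classical
  obtain ⟨t, ht, F, hF, rfl⟩ := hG
  have hrep : ∀ B : Finset (Fin k), ∃ s : ∀ i, Set (B → X i), B ∈ t →
      IsNull ω (F B ∆ internal ω fun i => (fun (p : Fin k → X i) (j : B) => p j) ⁻¹' s i) := by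
    intro B
    by_cases hB : B ∈ t
    · obtain ⟨D, ⟨s, hs⟩, hDF⟩ := hF B hB
      refine ⟨s, fun _ => ?_⟩
      rw [← hDF, ← proj_preimage_internal]
      exact hs.preimage_proj
    · exact ⟨fun _ => ∅, fun h => absurd h hB⟩
  choose s hs using hrep
  -- the factors from `σ(B)` are collected at the coordinate of `A` that `B` misses
  refine ⟨fun i a => {q | ∀ B ∈ t, (a : Fin k) ∉ B → ∀ h : B ⊆ A,
    (fun j : B => q ⟨j, h j.2⟩) ∈ s B i}, ?_, ?_⟩
  · intro i a x y hxy hx B hB haB h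
    convert hx B hB haB h using 2 with j
    exact (hxy _ fun hja => haB (by rw [← hja]; exact j.2)).symm
  · convert IsNull.symmDiff_biInter hs using 3
    funext i
    ext p
    simp only [Set.mem_preimage, Set.mem_iInter, Set.mem_ofPred_eq]
    constructor
    · intro h B hB
      obtain ⟨hBA, hcard⟩ := ht hB
      obtain ⟨a, haA, haB⟩ := Finset.exists_mem_notMem_of_card_lt_card
        (show B.card < A.card by lia)
      exact h ⟨a, haA⟩ B hB haB hBA
    · intro h a B hB _ _
      exact h B hB

/-- The functions `f` define internal colour classes that have at most their share of each set of
the `π`-system that generates `σ(A)^*`. -/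
theorem measureReal_inter_le {A : Finset (Fin k)} {n : ℕ} {f : ∀ i, (A → X i) → Fin n}
    (hf : ∀ ε : ℝ, 0 < ε → ε ≤ 1 → ∀ᶠ i in (ω : Filter ℕ), IsQuasirandom ε (f i))
    {G : Set (Power ω X (Fin k))}
    (hG : G ∈ piiUnionInter (fun B => {s | MeasurableSet[sigma ω X B] s})
      {B : Finset (Fin k) | B ⊆ A ∧ B.card + 1 = A.card}) (j : Fin n) :
    (measure ω fun i => Fin k → X i).real
        (proj ω X A ⁻¹' (internal ω fun i => f i ⁻¹' {j}) ∩ G)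
      ≤ (measure ω fun i => Fin k → X i).real G / n := by
  obtain ⟨T, hT, hGT⟩ := exists_internal_of_mem_piiUnionInter hG
  have hinter : IsNull ω ((proj ω X A ⁻¹' (internal ω fun i => f i ⁻¹' {j}) ∩ G) ∆
      internal ω fun i =>
        (fun (p : Fin k → X i) (j : A) => p j) ⁻¹' (f i ⁻¹' {j} ∩ ⋂ a, T i a)) := by
    rw [proj_preimage_internal]
    exact (isNull_symmDiff_self _).symmDiff_inter hGT
  have hlim : ∀ {B : Set (Power ω X (Fin k))} {s : ∀ i, Set (A → X i)},
      IsNull ω (B ∆ internal ω fun i => (fun (p : Fin k → X i) (j : A) => p j) ⁻¹' s i) →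
      Tendsto (fun i => ((s i).ncard : ℝ) / Nat.card (A → X i)) ω
        (𝓝 ((measure ω fun i => Fin k → X i).real B)) := by
    intro B s h
    have h1 := (ENNReal.tendsto_toReal (measure_ne_top (measure ω fun i => Fin k → X i) B)).comp
      (measure_eq h ▸ tendsto_ultraDensity (ω := ω) fun i =>
        (fun (p : Fin k → X i) (j : A) => p j) ⁻¹' s i)
    refine h1.congr fun i => ?_
    rw [Function.comp_apply, density_preimage]
    simp [density, ENNReal.toReal_div]
  refine le_of_forall_pos_le_add fun ε hε => ?_
  refine le_of_tendsto_of_tendsto (hlim hinter) (((hlim hGT).div_const (n : ℝ)).add_const ε) ?_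
  filter_upwards [hf (min ε 1) (by positivity) (min_le_right _ _)] with i hi
  have h := hi.mono (min_le_left ε 1) j (T i) (hT i)
  have hpos : (0 : ℝ) < Nat.card (A → X i) := by exact_mod_cast Nat.card_pos
  rw [div_le_iff₀ hpos]
  refine h.trans (le_of_eq ?_)
  field_simp

end Projection

/-- Sets of which each has at most its share `1 / n` of a set that they partition have exactly that
share. -/
theorem measureReal_inter_eq_of_forall_le {Ω : Type*} [MeasurableSpace Ω] {μ : Measure Ω}
    [IsFiniteMeasure μ] {n : ℕ} {S : Fin n → Set Ω} (hS : ∀ j, MeasurableSet (S j))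
    (hdisj : Pairwise (Function.onFun Disjoint S)) (huniv : ⋃ j, S j = Set.univ) {G : Set Ω}
    (hG : MeasurableSet G) (hle : ∀ j, μ.real (S j ∩ G) ≤ μ.real G / n) (j : Fin n) :
    μ.real (S j ∩ G) = μ.real G / n := by
  have hsum : ∑ l, μ.real (S l ∩ G) = ∑ _l : Fin n, μ.real G / n := by
    rw [← measureReal_iUnion_fintype
      (fun a b hab => (hdisj hab).mono Set.inter_subset_left Set.inter_subset_left)
      (fun l => (hS l).inter hG), ← Set.iUnion_inter, huniv, Set.univ_inter, Finset.sum_const,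
      Finset.card_univ, Fintype.card_fin, nsmul_eq_mul,
      mul_div_cancel₀ _ (Nat.cast_ne_zero.2 j.pos.ne')]
  exact (Finset.sum_eq_sum_iff_of_le fun l _ => hle l).1 hsum j (Finset.mem_univ j)

/-! ### The conditional expectation of an independent set -/

open ProbabilityTheory in
/-- If `S` is independent of a `π`-system that generates `m₂`, then the conditional expectation of
its indicator is its measure. -/
theorem condExp_indicator_eq_measureReal {Ω : Type*} {m₂ m : MeasurableSpace Ω} {μ : Measure Ω}
    [IsProbabilityMeasure μ] (hle : m₂ ≤ m) {S : Set Ω} (hS : MeasurableSet[m] S)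
    {p : Set (Set Ω)} (hp : IsPiSystem p) (hgen : m₂ = MeasurableSpace.generateFrom p)
    (h : ∀ G ∈ p, μ (S ∩ G) = μ S * μ G) :
    μ[S.indicator fun _ => (1 : ℝ) | m₂] =ᵐ[μ] fun _ => μ.real S := by
  have hle₁ : MeasurableSpace.generateFrom {S} ≤ m :=
    MeasurableSpace.generateFrom_le fun t ht => by rwa [Set.mem_singleton_iff.1 ht]
  have hind : Indep (MeasurableSpace.generateFrom {S}) m₂ μ := by
    refine IndepSets.indep hle₁ hle (IsPiSystem.singleton S) hp rfl hgen ?_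
    rw [IndepSets_iff]
    rintro t G rfl hG
    exact h G hG
  have hmeas : StronglyMeasurable[MeasurableSpace.generateFrom {S}]
      (S.indicator fun _ => (1 : ℝ)) :=
    stronglyMeasurable_const.indicator
      (MeasurableSpace.measurableSet_generateFrom (Set.mem_singleton S))
  refine (condExp_indep_eq hle₁ hle hmeas hind).trans (Eventually.of_forall fun _ => ?_)
  exact integral_indicator_one hS

end Loeb

theorem mainTheorem10 {X : ℕ → Type*} [∀ i, Finite (X i)] [∀ i, Nonempty (X i)]
    (hX : StrictMono fun i => Nat.card (X i))
    (ω : Ultrafilter ℕ) (hω : (ω : Filter ℕ) ≤ Filter.cofinite)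
    (k : ℕ) (A : Finset (Fin k)) (hA : A.Nonempty) (n : ℕ) (hn : 1 ≤ n) :
    ∃ S : Fin n → Set (Loeb.Power ω X A),
      (∀ j, MeasurableSet (S j)) ∧
      Pairwise (Function.onFun Disjoint S) ∧
      (⋃ j, S j) = Set.univ ∧
      ∀ j, MeasureTheory.condExp (Loeb.sigmaStar ω X A)
          (Loeb.measure ω fun i => Fin k → X i)
          ((Loeb.proj ω X A ⁻¹' S j).indicator fun _ => (1 : ℝ))
        =ᵐ[Loeb.measure ω fun i => Fin k → X i] fun _ => 1 / (n : ℝ) := by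
  have : Nonempty A := hA.to_subtype
  choose f hf using fun i => Loeb.exists_best_colouring (J := A) (Z := X i) hn
  have hquasi : ∀ ε : ℝ, 0 < ε → ε ≤ 1 →
      ∀ᶠ i in (ω : Filter ℕ), Loeb.IsQuasirandom ε (f i) := by
    intro ε hε0 hε1
    obtain ⟨N₀, hN₀⟩ := Loeb.exists_isQuasirandom A hn hε0 hε1
    have hlarge := hω (Nat.cofinite_eq_atTop ▸ hX.tendsto_atTop.eventually_ge_atTop N₀)
    filter_upwards [hlarge] with i hi
    exact hf i ε (hN₀ (X i) hi)
  set S : Fin n → Set (Loeb.Power ω X A) := fun j => Loeb.internal ω fun i => f i ⁻¹' {j}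
  have hSmeas : ∀ j, MeasurableSet (S j) := fun j => Loeb.measurableSet_internal _
  have hSdisj : Pairwise (Function.onFun Disjoint S) := Loeb.disjoint_internal_colour f
  have hSuniv : ⋃ j, S j = Set.univ := Loeb.iUnion_internal_colour f
  refine ⟨S, hSmeas, hSdisj, hSuniv, fun j => ?_⟩
  set μ := Loeb.measure ω fun i => Fin k → X i
  set p := piiUnionInter (fun B => {s | MeasurableSet[Loeb.sigma ω X B] s})
    {B : Finset (Fin k) | B ⊆ A ∧ B.card + 1 = A.card}
  have hgen : Loeb.sigmaStar ω X A = MeasurableSpace.generateFrom p :=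
    (generateFrom_piiUnionInter_measurableSet _ _).symm
  have hle := Loeb.sigmaStar_le ω X A
  have hpre : ∀ l, MeasurableSet (Loeb.proj ω X A ⁻¹' S l) := fun l =>
    Loeb.measurable_proj ω X A (hSmeas l)
  have hshare : ∀ G ∈ p, μ.real (Loeb.proj ω X A ⁻¹' S j ∩ G) = μ.real G / n := by
    intro G hG
    have hGmeas : MeasurableSet G :=
      hle G (hgen ▸ MeasurableSpace.measurableSet_generateFrom hG)
    exact Loeb.measureReal_inter_eq_of_forall_le hpre
      (fun a b hab => (hSdisj hab).preimage _)
      (by rw [← Set.preimage_iUnion, hSuniv, Set.preimage_univ]) hGmeas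
      (fun l => Loeb.measureReal_inter_le hquasi hG l) j
  -- the whole space is the empty intersection, so each colour class has measure `1 / n`
  have hSj : μ.real (Loeb.proj ω X A ⁻¹' S j) = 1 / n := by
    have := hshare Set.univ ⟨∅, by simp, fun _ => Set.univ, by simp, by simp⟩
    rwa [Set.inter_univ, probReal_univ] at this
  rw [← hSj]
  refine Loeb.condExp_indicator_eq_measureReal hle (hpre j)
    (isPiSystem_piiUnionInter _ (fun B => (Loeb.sigma ω X B).isPiSystem_measurableSet) _) hgen
    fun G hG => ?_
  rw [← ENNReal.toReal_eq_toReal_iff' (measure_ne_top _ _)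
    (ENNReal.mul_ne_top (measure_ne_top _ _) (measure_ne_top _ _)), ENNReal.toReal_mul]
  change μ.real _ = μ.real _ * μ.real _
  rw [hshare G hG, hSj]
  ring
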